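/- Let $\mathfrak H$ be a separable infinite-dimensional complex Hilbert space with scalar product $(\cdot,\cdot)$. A linear operator $A$ in $\mathfrak H$ is called *$m$-sectorial* if it is densely defined, its numerical range $\{(Au,u): u\in\operatorname{dom}A,\ \|u\|=1\}$ is contained in a sector $\{z\in\mathbb C: |\arg z|\le\alpha\}\cup\{0\}$ for some $\alpha\in[0,\pi/2)$, and $\operatorname{ran}(A-\lambda I)=\mathfrak H$ for some $\lambda\in\mathbb C$ with $\operatorname{Re}\lambda<0$. It *has compact resolvent* if $(A-\lambda I)^{-1}$ is a compact operator on $\mathfrak H$ for some (equivalently, $A$ having non-empty resolvent set, for every) $\lambda$ in the resolvent set of $A$. Call a pair $(L,G)$ *admissible* if $L$ is a selfadjoint operator in $\mathfrak H$ with $\ker L=\{0\}$ and $G$ is a bounded selfadjoint operator on $\mathfrak H$ with $\ker G=\{0\}$ and $\operatorname{ran}G\cap\operatorname{dom}L=\{0\}$. For such a pair, $L(I+iG)L$ denotes the product on its natural domain $\{u\in\operatorname{dom}L:(I+iG)Lu\in\operatorname{dom}L\}$. Then: 1. There is an $m$-sectorial operator $A$ in $\mathfrak H$ with $\operatorname{dom}A\cap\operatorname{dom}A^*=\{0\}$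 which has compact resolvent, and there is another one, with the same properties, which does not have compact resolvent. Both can be chosen of the form $A=L(I+iG)L$ with an admissible pair $(L,G)$. 2. Every $m$-sectorial operator $A$ in $\mathfrak H$ with $\operatorname{dom}A\cap\operatorname{dom}A^*=\{0\}$ satisfies $\ker A=\{0\}$. 3. For every admissible pair $(L,G)$, the operator $A=L(I+iG)L$ is $m$-sectorial and $\operatorname{dom}A\cap\operatorname{dom}A^*=\{0\}$. 4. For every unbounded selfadjoint operator $L$ in $\mathfrak H$ with $\ker L=\{0\}$ there is a $G$ such that the pair $(L,G)$ is admissible. -/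

import Mathlib

open scoped LinearPMap

namespace SectorialOps

variable {H : Type*} [NormedAddCommGroup H] [InnerProductSpace ℂ H]

/-- The numerical range `W(T) = {(T u, u) : u ∈ dom T, ‖u‖ = 1}`. Mathlib's inner product is linear
in its second argument, so `(T u, u)` reads `inner ℂ u (T u)`. -/
def numericalRange (T : H →ₗ.[ℂ] H) : Set ℂ :=
  {z | ∃ u : T.domain, ‖(u : H)‖ = 1 ∧ inner ℂ (u : H) (T u) = z}

/-- The closed sector with vertex `0` and semi-angle `α` (it contains `0`, as `Complex.arg 0 = 0`). -/
def closedSector (α : ℝ) : Set ℂ :=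
  {z | |Complex.arg z| ≤ α}

/-- `T` is accretive: its numerical range lies in the closed right half-plane. -/
def IsAccretive (T : H →ₗ.[ℂ] H) : Prop :=
  numericalRange T ⊆ {z | 0 ≤ z.re}

/-- `T` is m-accretive: it is accretive and densely defined, and `ran (T - z I) = H` for some `z` in
the open left half-plane. -/
def IsMAccretive (T : H →ₗ.[ℂ] H) : Prop :=
  IsAccretive T ∧ Dense (T.domain : Set H) ∧
    ∃ z : ℂ, z.re < 0 ∧ ∀ f : H, ∃ u : T.domain, T u - z • (u : H) = f

/-- `T` is sectorial with vertex `0` and semi-angle `α ∈ [0, π/2)`. -/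
def IsSectorialWith (α : ℝ) (T : H →ₗ.[ℂ] H) : Prop :=
  0 ≤ α ∧ α < Real.pi / 2 ∧ numericalRange T ⊆ closedSector α

/-- `T` is m-sectorial: sectorial with some semi-angle in `[0, π/2)`, and m-accretive. -/
def IsMSectorial (T : H →ₗ.[ℂ] H) : Prop :=
  (∃ α : ℝ, IsSectorialWith α T) ∧ IsMAccretive T

/-- `R` is the resolvent `(T - z I)⁻¹`, a bounded operator on all of `H`. In particular `z` is then in
the resolvent set of `T`. -/
def IsResolventAt (T : H →ₗ.[ℂ] H) (z : ℂ) (R : H →L[ℂ] H) : Prop :=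
  (∀ u : T.domain, R (T u - z • (u : H)) = u) ∧
    ∀ f : H, ∃ h : R f ∈ T.domain, T ⟨R f, h⟩ - z • R f = f

/-- `T` has compact resolvent: `(T - z I)⁻¹` exists as a compact operator for some `z` in the
resolvent set (equivalently, by the resolvent identity, the resolvent set is non-empty and this holds
for all of its elements). -/
def HasCompactResolvent (T : H →ₗ.[ℂ] H) : Prop :=
  ∃ (z : ℂ) (R : H →L[ℂ] H), IsResolventAt T z R ∧ IsCompactOperator R

/-- `T` is an unbounded operator. -/
def IsUnbounded (T : H →ₗ.[ℂ] H) : Prop :=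
  ¬ ∃ C : ℝ, ∀ u : T.domain, ‖T u‖ ≤ C * ‖(u : H)‖

/-- The product `S T` on its natural domain `{u ∈ dom T : T u ∈ dom S}`. -/
def product (S T : H →ₗ.[ℂ] H) : H →ₗ.[ℂ] H where
  domain := (S.domain.comap T.toFun).map T.domain.subtype
  toFun := S.toFun ∘ₗ (T.toFun.restrict (p := S.domain.comap T.toFun) (q := S.domain)
      fun _ hu => hu) ∘ₗ
    (Submodule.equivSubtypeMap T.domain (S.domain.comap T.toFun)).symm.toLinearMap

theorem mem_product_domain {S T : H →ₗ.[ℂ] H} {u : H} :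
    u ∈ (product S T).domain ↔ ∃ h : u ∈ T.domain, T ⟨u, h⟩ ∈ S.domain := by
  simp [product, Submodule.mem_map]

theorem product_apply {S T : H →ₗ.[ℂ] H} {u : H} (hu : u ∈ (product S T).domain)
    (h : u ∈ T.domain) (h' : T ⟨u, h⟩ ∈ S.domain) :
    product S T ⟨u, hu⟩ = S ⟨T ⟨u, h⟩, h'⟩ := by
  have key : (Submodule.equivSubtypeMap T.domain (S.domain.comap T.toFun)).symm ⟨u, hu⟩
      = ⟨⟨u, h⟩, h'⟩ := by
    rw [LinearEquiv.symm_apply_eq]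
    rfl
  change S.toFun (T.toFun.restrict (p := S.domain.comap T.toFun) (q := S.domain) (fun _ hu => hu)
    ((Submodule.equivSubtypeMap T.domain (S.domain.comap T.toFun)).symm ⟨u, hu⟩)) = _
  rw [key]
  rfl

/-- The operator `L (I + i G) L` on its natural domain
`{u ∈ dom L : (I + i G) L u ∈ dom L}`, for an operator `L` and an everywhere defined bounded `G`. -/
noncomputable def sandwich (L : H →ₗ.[ℂ] H) (G : H →L[ℂ] H) : H →ₗ.[ℂ] H :=
  product L (((1 + Complex.I • G : H →L[ℂ] H) : H →ₗ[ℂ] H).compPMap L)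

/-- `L` is selfadjoint with trivial kernel, and `G` is bounded and selfadjoint with trivial kernel and
`ran G ∩ dom L = {0}`. -/
def IsAdmissible [CompleteSpace H] (L : H →ₗ.[ℂ] H) (G : H →L[ℂ] H) : Prop :=
  IsSelfAdjoint L ∧ LinearMap.ker L.toFun = ⊥ ∧
    IsSelfAdjoint G ∧ LinearMap.ker (G : H →ₗ[ℂ] H) = ⊥ ∧
    LinearMap.range (G : H →ₗ[ℂ] H) ⊓ L.domain = ⊥

end SectorialOps

/-!
For a selfadjoint `L` and a bounded selfadjoint `G`, the form of `A = L (I + i G) L` is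
`‖L u‖² + i (G L u, L u)`. Its numerical range lies in the sector of semi-angle `arctan ‖G‖`, and the
Lax–Milgram theorem on `dom L` gives `ran (A + I) = H` (`exists_sandwich_add_eq`). The same holds for
`L (I - i G) L`, which is therefore all of `A*` (`adjoint_sandwich_domain_le`). For `u` in both
domains, `(I + i G) L u` and `(I - i G) L u` lie in `dom L`, hence so does `G L u`; admissibility then
forces `G L u = 0` and `u = 0`.

That `dom A ∩ dom A* = {0}` implies `ker A = {0}` is a fact on densely defined accretive operators:
their kernel is contained in the domain of the adjoint (`mem_adjoint_domain_of_apply_eq_zero`).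

The main construction is that of `G` for a given unbounded `L` (`exists_isAdmissible`). As `L` is
unbounded, `(L - i)⁻¹` is not bounded below on any subspace of finite codimension, so there is an
orthonormal sequence `fₙ` with `‖(L - i)⁻¹ fₙ‖` decreasing as fast as desired. Every `y` in `dom L`
has coefficients `(fₙ, y)` that decay just as fast. Complete `fₙ` by vectors orthogonal to it to a
total sequence `βₙ`, with `β₂ₙ = fₙ`, and let `Q x = ∑ cₙ (βₙ, x) kₙ` with values in `ℓ²`, where
`kₙ = (zₙᵐ)ₘ`, `zₙ = 2⁻ⁿ⁻¹` and the `cₙ` are positive weights. A Vandermonde argument shows that `Q`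
is injective. For `G = Q* Q` the coefficient `(fₙ, G x)` is `c₂ₙ` times the value at `z₂ₙ` of the power
series with coefficient sequence `Q x`. A nonzero power series cannot decay at the points `z₂ₙ` faster
than every power of them, so `G x ∈ dom L` implies `Q x = 0` and `x = 0`. This one implication yields
both `ker G = {0}` and `ran G ∩ dom L = {0}`.

For the two examples, `L` is the inverse of a bounded injective selfadjoint operator `D`. If `D` is
compact, then `(A + I)⁻¹ = D (L (A + I)⁻¹)` is compact. If `L` fixes an infinite orthonormal sequence,
then `(A + I)⁻¹` is bounded away from zero on it, which no compact operator is.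
-/

open scoped LinearPMap

namespace SectorialOps

variable {H : Type*} [NormedAddCommGroup H] [InnerProductSpace ℂ H]

/-! ### Resolvents -/

/-- An operator `T` for which `T - z` is onto and bounded below has a bounded resolvent at `z`. -/
theorem exists_isResolventAt {T : H →ₗ.[ℂ] H} {z : ℂ} (C : ℝ)
    (hC : ∀ u : T.domain, ‖(u : H)‖ ≤ C * ‖T u - z • (u : H)‖)
    (hT : ∀ f : H, ∃ u : T.domain, T u - z • (u : H) = f) :
    ∃ R : H →L[ℂ] H, IsResolventAt T z R := by
  let S : T.domain →ₗ[ℂ] H := T.toFun - z • T.domain.subtype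
  have hS : ∀ u, S u = T u - z • (u : H) := fun u => rfl
  have hinj : Function.Injective S := by
    rw [injective_iff_map_eq_zero]
    intro u hu
    have h := hC u
    rw [← hS, hu, norm_zero, mul_zero] at h
    exact Subtype.ext (norm_le_zero_iff.1 h)
  let e := LinearEquiv.ofBijective S ⟨hinj, hT⟩
  have he : ∀ f, T (e.symm f) - z • (e.symm f : H) = f := fun f => e.apply_symm_apply f
  refine ⟨(T.domain.subtype ∘ₗ e.symm.toLinearMap).mkContinuous C fun f => ?_, fun u => ?_,
    fun f => ⟨(e.symm f).2, he f⟩⟩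
  · have h := hC (e.symm f)
    rwa [he] at h
  · exact congrArg Subtype.val (e.symm_apply_apply u)

/-- By the resolvent identity, compactness of the resolvent passes from one point of the resolvent
set to any other. -/
theorem IsResolventAt.isCompactOperator {T : H →ₗ.[ℂ] H} {z w : ℂ} {R K : H →L[ℂ] H}
    (hR : IsResolventAt T z R) (hK : IsResolventAt T w K) (hc : IsCompactOperator R) :
    IsCompactOperator K := by
  have h : K = R ∘L (1 + (w - z) • K) := by
    ext f
    obtain ⟨h, hf⟩ := hK.2 f
    have h' := hR.1 ⟨K f, h⟩
    rw [sub_eq_iff_eq_add.1 hf] at h'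
    refine h'.symm.trans (congrArg R ?_)
    change f + w • K f - z • K f = f + (w - z) • K f
    module
  rw [h]
  exact hc.comp_clm _

/-! ### Selfadjoint operators -/

section SelfAdjoint

variable [CompleteSpace H] {L : H →ₗ.[ℂ] H}

theorem inner_apply_comm (hL : IsSelfAdjoint L) (u v : L.domain) :
    inner ℂ (L u) (v : H) = inner ℂ (u : H) (L v) := by
  have h := LinearPMap.adjoint_isFormalAdjoint hL.dense_domain
  rw [LinearPMap.isSelfAdjoint_def.1 hL] at h
  exact h u v

theorem exists_mem_domain_of_inner (hL : IsSelfAdjoint L) {y w : H}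
    (h : ∀ u : L.domain, inner ℂ w (u : H) = inner ℂ y (L u)) :
    ∃ hy : y ∈ L.domain, L ⟨y, hy⟩ = w := by
  have : ∃ hy : y ∈ L†.domain, L† ⟨y, hy⟩ = w :=
    ⟨LinearPMap.mem_adjoint_domain_of_exists y ⟨w, h⟩,
      LinearPMap.adjoint_apply_eq hL.dense_domain _ h⟩
  rwa [LinearPMap.isSelfAdjoint_def.1 hL] at this

theorem norm_sub_smul_sq (hL : IsSelfAdjoint L) {z : ℂ} (hz : z = Complex.I ∨ z = -Complex.I)
    (u : L.domain) : ‖L u - z • (u : H)‖ ^ 2 = ‖L u‖ ^ 2 + ‖(u : H)‖ ^ 2 := by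
  have him : (inner ℂ (L u) (u : H)).im = 0 := by
    rw [← Complex.conj_eq_iff_im, inner_conj_symm, inner_apply_comm hL]
  rw [norm_sub_sq (𝕜 := ℂ), inner_smul_right, norm_smul]
  rcases hz with rfl | rfl <;> simp [him]

theorem norm_le_norm_sub_smul (hL : IsSelfAdjoint L) {z : ℂ}
    (hz : z = Complex.I ∨ z = -Complex.I) (u : L.domain) :
    ‖(u : H)‖ ≤ ‖L u - z • (u : H)‖ := by
  have h := norm_sub_smul_sq hL hz u
  exact le_of_sq_le_sq (by nlinarith [sq_nonneg ‖L u‖]) (norm_nonneg _)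

/-- For a selfadjoint operator, `± i` lies in the resolvent set. -/
theorem exists_isResolventAt_of_isSelfAdjoint (hL : IsSelfAdjoint L) {z : ℂ}
    (hz : z = Complex.I ∨ z = -Complex.I) : ∃ R : H →L[ℂ] H, IsResolventAt L z R := by
  refine exists_isResolventAt 1 (fun u => by simpa using norm_le_norm_sub_smul hL hz u) ?_
  let S : L.domain →ₗ[ℂ] H := L.toFun - z • L.domain.subtype
  have hS : ∀ u, S u = L u - z • (u : H) := fun u => rfl
  have hclosed : IsClosed (LinearMap.range S : Set H) := by
    refine IsSeqClosed.isClosed fun f g hf hg => ?_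
    choose u hu using hf
    have hcau : CauchySeq fun n => (u n : H) := by
      refine Metric.cauchySeq_iff.2 fun ε hε => ?_
      obtain ⟨N, hN⟩ := Metric.cauchySeq_iff.1 hg.cauchySeq ε hε
      refine ⟨N, fun m hm n hn => lt_of_le_of_lt ?_ (hN m hm n hn)⟩
      rw [dist_eq_norm, dist_eq_norm, ← hu, ← hu, ← map_sub]
      exact norm_le_norm_sub_smul hL hz (u m - u n)
    obtain ⟨v, hv⟩ := cauchySeq_tendsto_of_complete hcau
    have hLu : Filter.Tendsto (fun n => L (u n)) Filter.atTop (nhds (g + z • v)) := by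
      refine (hg.add (hv.const_smul z)).congr fun n => ?_
      rw [← hu, hS]
      abel
    -- The graph of `L` is closed, as `L` is an adjoint.
    obtain ⟨h, h'⟩ := exists_mem_domain_of_inner hL (y := v) (w := g + z • v) fun x =>
      tendsto_nhds_unique (hLu.inner tendsto_const_nhds) <| by
        simp_rw [inner_apply_comm hL]
        exact hv.inner tendsto_const_nhds
    exact ⟨⟨v, h⟩, by rw [hS, h']; simp⟩
  have : LinearMap.range S = ⊤ := by
    have := hclosed.completeSpace_coe
    rw [← Submodule.orthogonal_eq_bot_iff, Submodule.eq_bot_iff]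
    intro y hy
    rw [Submodule.mem_orthogonal'] at hy
    obtain ⟨h, h'⟩ := exists_mem_domain_of_inner hL (y := y) (w := (starRingEnd ℂ z) • y) fun x => by
      have := hy (S x) ⟨x, rfl⟩
      rw [hS, inner_sub_right, inner_smul_right, sub_eq_zero] at this
      rw [inner_smul_left, this]
      simp
    have h2 := norm_le_norm_sub_smul hL (z := starRingEnd ℂ z)
      (by rcases hz with rfl | rfl <;> simp) ⟨y, h⟩
    rw [h', sub_self, norm_zero] at h2
    exact norm_le_zero_iff.1 h2
  exact fun f => LinearMap.range_eq_top.1 this f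

end SelfAdjoint

/-! ### Accretive operators -/

theorem zero_le_re_inner {T : H →ₗ.[ℂ] H} (hT : IsAccretive T) (u : T.domain) :
    0 ≤ (inner ℂ (u : H) (T u)).re := by
  by_cases h0 : (u : H) = 0
  · simp [h0]
  have hn : ‖(u : H)‖ ≠ 0 := norm_ne_zero_iff.2 h0
  have h : 0 ≤ (inner ℂ ((((‖(u : H)‖⁻¹ : ℝ) : ℂ) • u : T.domain) : H)
      (T (((‖(u : H)‖⁻¹ : ℝ) : ℂ) • u))).re :=
    hT ⟨((‖(u : H)‖⁻¹ : ℝ) : ℂ) • u, by simp [norm_smul, hn], rfl⟩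
  rw [LinearPMap.map_smul, Submodule.coe_smul, inner_smul_left, inner_smul_right,
    Complex.conj_ofReal, Complex.re_ofReal_mul, Complex.re_ofReal_mul, ← mul_assoc] at h
  exact nonneg_of_mul_nonneg_right h (by positivity)

/-- The kernel of a densely defined accretive operator lies in the domain of the adjoint: since
`Re (A (v + s u), v + s u) = Re ((A v, v) + conj s • (A v, u))` stays nonnegative for all scalars
`s`, the number `(A v, u)` vanishes for every `v`. -/
theorem mem_adjoint_domain_of_apply_eq_zero [CompleteSpace H] {T : H →ₗ.[ℂ] H} (hT : IsAccretive T)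
    {u : T.domain} (hu : T u = 0) : (u : H) ∈ T†.domain := by
  refine LinearPMap.mem_adjoint_domain_of_exists _ ⟨0, fun v => ?_⟩
  set w := inner ℂ (u : H) (T v) with hw
  rw [inner_zero_left]
  by_contra hne
  have hpos : 0 < ‖w‖ ^ 2 := by have := norm_pos_iff.2 (Ne.symm hne); positivity
  have key : ∀ t : ℝ, 0 ≤ (inner ℂ (v : H) (T v)).re - t * ‖w‖ ^ 2 := by
    intro t
    have h := zero_le_re_inner hT (v + (-(t : ℂ) * w) • u)
    rw [LinearPMap.map_add, LinearPMap.map_smul, hu, smul_zero, add_zero, Submodule.coe_add,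
      Submodule.coe_smul, inner_add_left, inner_smul_left, ← hw, map_mul, map_neg,
      Complex.conj_ofReal, mul_assoc, ← Complex.normSq_eq_conj_mul_self, Complex.normSq_eq_norm_sq,
      ← Complex.ofReal_neg, ← Complex.ofReal_mul, Complex.add_re, Complex.ofReal_re] at h
    linarith
  have := key (((inner ℂ (v : H) (T v)).re + 1) / ‖w‖ ^ 2)
  rw [div_mul_cancel₀ _ hpos.ne'] at this
  linarith

theorem ker_eq_bot_of_isMSectorial [CompleteSpace H] {A : H →ₗ.[ℂ] H} (hA : IsMSectorial A)
    (h : A.domain ⊓ A†.domain = ⊥) : LinearMap.ker A.toFun = ⊥ := by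
  rw [LinearMap.ker_eq_bot']
  intro u hu
  have : (u : H) ∈ A.domain ⊓ A†.domain := ⟨u.2, mem_adjoint_domain_of_apply_eq_zero hA.2.1 hu⟩
  rw [h] at this
  exact Subtype.ext this

theorem abs_arg_le_arctan {z : ℂ} {g : ℝ} (hz : 0 < z.re) (h : |z.im| ≤ g * z.re) :
    |z.arg| ≤ Real.arctan g := by
  have h1 : |z.arg| < Real.pi / 2 := Complex.abs_arg_lt_pi_div_two_iff.2 (Or.inl hz)
  obtain ⟨h2, h3⟩ := abs_lt.1 h1
  have hle : |z.im / z.re| ≤ g := by rwa [abs_div, abs_of_pos hz, div_le_iff₀ hz]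
  obtain ⟨h4, h5⟩ := abs_le.1 hle
  rw [← Real.arctan_tan h2 h3, Complex.tan_arg, abs_le, ← Real.arctan_neg]
  exact ⟨Real.arctan_strictMono.monotone h4, Real.arctan_strictMono.monotone h5⟩

/-! ### The operators `L (I + i G) L` -/

theorem mem_sandwich_domain {L : H →ₗ.[ℂ] H} {G : H →L[ℂ] H} {u : H} :
    u ∈ (sandwich L G).domain ↔
      ∃ h : u ∈ L.domain, L ⟨u, h⟩ + Complex.I • G (L ⟨u, h⟩) ∈ L.domain :=
  mem_product_domain

theorem sandwich_apply {L : H →ₗ.[ℂ] H} {G : H →L[ℂ] H} {u : H} (hu : u ∈ (sandwich L G).domain)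
    (h : u ∈ L.domain) (h' : L ⟨u, h⟩ + Complex.I • G (L ⟨u, h⟩) ∈ L.domain) :
    sandwich L G ⟨u, hu⟩ = L ⟨L ⟨u, h⟩ + Complex.I • G (L ⟨u, h⟩), h'⟩ :=
  product_apply hu h h'

section Sandwich

variable [CompleteSpace H] {L : H →ₗ.[ℂ] H} {G : H →L[ℂ] H}

/-- The sesquilinear form of `L (I + i G) L`. -/
theorem inner_sandwich (hL : IsSelfAdjoint L) (u : (sandwich L G).domain) (hu : (u : H) ∈ L.domain)
    (v : L.domain) : inner ℂ (v : H) (sandwich L G u) =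
      inner ℂ (L v) (L ⟨u, hu⟩) + Complex.I * inner ℂ (L v) (G (L ⟨u, hu⟩)) := by
  obtain ⟨h, h'⟩ := mem_sandwich_domain.1 u.2
  rw [sandwich_apply u.2 h h', ← inner_apply_comm hL, inner_add_right, inner_smul_right]

theorem exists_ofReal_eq_inner (hG : IsSelfAdjoint G) (x : H) :
    ∃ r : ℝ, inner ℂ x (G x) = r ∧ |r| ≤ ‖G‖ * ‖x‖ ^ 2 := by
  have hs : inner ℂ x (G x) = ((inner ℂ x (G x)).re : ℂ) := by
    refine (Complex.conj_eq_iff_re.1 ?_).symm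
    rw [inner_conj_symm]
    exact hG.isSymmetric x x
  refine ⟨_, hs, (Complex.abs_re_le_norm _).trans ((norm_inner_le_norm _ _).trans ?_)⟩
  nlinarith [G.le_opNorm x, norm_nonneg x]

theorem re_inner_sandwich (hL : IsSelfAdjoint L) (hG : IsSelfAdjoint G) (u : (sandwich L G).domain)
    (hu : (u : H) ∈ L.domain) :
    (inner ℂ (u : H) (sandwich L G u)).re = ‖L ⟨u, hu⟩‖ ^ 2 := by
  obtain ⟨r, hr, -⟩ := exists_ofReal_eq_inner hG (L ⟨u, hu⟩)
  rw [inner_sandwich hL u hu ⟨u, hu⟩, hr, inner_self_eq_norm_sq_to_K]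
  simp [← Complex.ofReal_pow]

theorem abs_im_inner_sandwich_le (hL : IsSelfAdjoint L) (hG : IsSelfAdjoint G)
    (u : (sandwich L G).domain) (hu : (u : H) ∈ L.domain) :
    |(inner ℂ (u : H) (sandwich L G u)).im| ≤ ‖G‖ * ‖L ⟨u, hu⟩‖ ^ 2 := by
  obtain ⟨r, hr, hr'⟩ := exists_ofReal_eq_inner hG (L ⟨u, hu⟩)
  rw [inner_sandwich hL u hu ⟨u, hu⟩, hr, inner_self_eq_norm_sq_to_K]
  simpa [← Complex.ofReal_pow] using hr'

/-- `L (I + i G) L + I` is onto, by the Lax–Milgram theorem for the form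
`((I + i G) L u, L v) + (u, v)` on `dom L`. Writing `u = R x` and `v = R y` with `R = (L + i)⁻¹`
turns the form into that of a bounded coercive operator. -/
theorem exists_sandwich_add_eq (hL : IsSelfAdjoint L) (hG : IsSelfAdjoint G) (f : H) :
    ∃ u : (sandwich L G).domain, sandwich L G u - (-1 : ℂ) • (u : H) = f := by
  obtain ⟨R, hR1, hR2⟩ := exists_isResolventAt_of_isSelfAdjoint hL (z := -Complex.I) (Or.inr rfl)
  choose hR hLR using hR2
  let X : H →L[ℂ] H := 1 - Complex.I • R
  have hX : ∀ x, L ⟨R x, hR x⟩ = X x := fun x => by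
    rw [sub_eq_iff_eq_add.1 (hLR x)]
    simp [X, sub_eq_add_neg]
  let C : H →L[ℂ] H := 1 + Complex.I • G
  let M : H →L[ℂ] H := X.adjoint ∘L C ∘L X + R.adjoint ∘L R
  have hM : ∀ x y, inner ℂ y (M x) = inner ℂ (X y) (C (X x)) + inner ℂ (R y) (R x) := fun x y => by
    simp [M, ContinuousLinearMap.adjoint_inner_right]
  have hre : ∀ x, (inner ℂ x (M x)).re = ‖x‖ ^ 2 := fun x => by
    have h := norm_sub_smul_sq hL (z := -Complex.I) (Or.inr rfl) ⟨R x, hR x⟩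
    rw [hLR] at h
    obtain ⟨r, hr, -⟩ := exists_ofReal_eq_inner hG (X x)
    rw [h, hM, hX]
    simp [C, hr, inner_self_eq_norm_sq_to_K,
      ← Complex.ofReal_pow]
  have hunit : IsUnit M := by
    refine ContinuousLinearMap.isUnit_of_forall_le_norm_inner_map M (c := 1) one_pos fun x => ?_
    rw [NNReal.coe_one, mul_one, ← hre, ← norm_inner_symm]
    exact Complex.re_le_norm _
  obtain ⟨x, hx⟩ := (ContinuousLinearMap.isUnit_iff_bijective.1 hunit).2 (R.adjoint f)
  have hweak : ∀ v : L.domain, inner ℂ (f - R x) (v : H) = inner ℂ (C (X x)) (L v) := fun v => by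
    have h := hM x (L v - (-Complex.I) • (v : H))
    have hv := hR1 v
    have hXv : X (L v - (-Complex.I) • (v : H)) = L v := by
      rw [← hX]; congr 1; exact Subtype.ext hv
    rw [hx, ContinuousLinearMap.adjoint_inner_right, hXv, hv] at h
    rw [← inner_conj_symm, ← inner_conj_symm (C (X x)), inner_sub_right, h]
    simp
  obtain ⟨h, h'⟩ := exists_mem_domain_of_inner hL hweak
  have hmem : L ⟨R x, hR x⟩ + Complex.I • G (L ⟨R x, hR x⟩) ∈ L.domain := by
    rw [hX]; exact h
  refine ⟨⟨R x, mem_sandwich_domain.2 ⟨hR x, hmem⟩⟩, ?_⟩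
  rw [sandwich_apply _ (hR x) hmem]
  have : (⟨L ⟨R x, hR x⟩ + Complex.I • G (L ⟨R x, hR x⟩), hmem⟩ : L.domain) = ⟨C (X x), h⟩ :=
    Subtype.ext (congrArg (fun w => w + Complex.I • G w) (hX x))
  rw [this, h']
  simp

theorem norm_sq_add_norm_sq_le (hL : IsSelfAdjoint L) (hG : IsSelfAdjoint G)
    (u : (sandwich L G).domain) (hu : (u : H) ∈ L.domain) :
    ‖L ⟨u, hu⟩‖ ^ 2 + ‖(u : H)‖ ^ 2 ≤
      ‖inner ℂ (u : H) (sandwich L G u - (-1 : ℂ) • (u : H))‖ := by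
  refine le_trans (le_of_eq ?_) (Complex.re_le_norm _)
  rw [inner_sub_right, Complex.sub_re, re_inner_sandwich hL hG u hu, neg_one_smul,
    inner_neg_right, inner_self_eq_norm_sq_to_K]
  simp [← Complex.ofReal_pow]

theorem norm_le_norm_sandwich_add (hL : IsSelfAdjoint L) (hG : IsSelfAdjoint G)
    (u : (sandwich L G).domain) :
    ‖(u : H)‖ ≤ ‖sandwich L G u - (-1 : ℂ) • (u : H)‖ := by
  obtain ⟨hu, -⟩ := mem_sandwich_domain.1 u.2
  rcases (norm_nonneg (u : H)).eq_or_lt with h0 | h0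
  · rw [← h0]; positivity
  have h := (norm_sq_add_norm_sq_le hL hG u hu).trans (norm_inner_le_norm _ _)
  refine le_of_mul_le_mul_left ?_ h0
  nlinarith [sq_nonneg ‖L ⟨u, hu⟩‖]

theorem exists_isResolventAt_sandwich (hL : IsSelfAdjoint L) (hG : IsSelfAdjoint G) :
    ∃ K : H →L[ℂ] H, IsResolventAt (sandwich L G) (-1) K :=
  exists_isResolventAt 1 (fun u => by simpa only [one_mul] using norm_le_norm_sandwich_add hL hG u)
    (exists_sandwich_add_eq hL hG)

theorem dense_sandwich_domain (hL : IsSelfAdjoint L) (hG : IsSelfAdjoint G) :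
    Dense ((sandwich L G).domain : Set H) := by
  rw [Submodule.dense_iff_topologicalClosure_eq_top, Submodule.topologicalClosure_eq_top_iff,
    Submodule.eq_bot_iff]
  intro w hw
  obtain ⟨u, rfl⟩ := exists_sandwich_add_eq hL hG w
  obtain ⟨hu, -⟩ := mem_sandwich_domain.1 u.2
  have h := norm_sq_add_norm_sq_le hL hG u hu
  rw [(Submodule.mem_orthogonal _ _).1 hw u u.2, norm_zero] at h
  have h0 : (u : H) = 0 := norm_eq_zero.1 (pow_eq_zero_iff two_ne_zero |>.1
    (by nlinarith [sq_nonneg ‖L ⟨u, hu⟩‖, sq_nonneg ‖(u : H)‖]))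
  have : u = 0 := Subtype.ext h0
  simp [this]

theorem isMSectorial_sandwich (hL : IsSelfAdjoint L) (hG : IsSelfAdjoint G)
    (hker : LinearMap.ker L.toFun = ⊥) : IsMSectorial (sandwich L G) := by
  refine ⟨⟨Real.arctan ‖G‖, Real.arctan_nonneg.2 (norm_nonneg _), Real.arctan_lt_pi_div_two _, ?_⟩,
    ?_, dense_sandwich_domain hL hG, -1, by simp, exists_sandwich_add_eq hL hG⟩
  · rintro z ⟨u, hu1, rfl⟩
    obtain ⟨hu, -⟩ := mem_sandwich_domain.1 u.2
    have hre := re_inner_sandwich hL hG u hu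
    refine abs_arg_le_arctan ?_ (by rw [hre]; exact abs_im_inner_sandwich_le hL hG u hu)
    rw [hre]
    have hne : L ⟨u, hu⟩ ≠ 0 := fun h0 => by
      have : (u : H) = 0 := congrArg Subtype.val (LinearMap.ker_eq_bot'.1 hker ⟨u, hu⟩ h0)
      simp [this] at hu1
    have := norm_pos_iff.2 hne
    positivity
  · rintro z ⟨u, -, rfl⟩
    obtain ⟨hu, -⟩ := mem_sandwich_domain.1 u.2
    change 0 ≤ (inner ℂ (u : H) (sandwich L G u)).re
    rw [re_inner_sandwich hL hG u hu]
    positivity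

/-- The adjoint of `L (I + i G) L` is `L (I - i G) L`; only the nontrivial inclusion of domains is
recorded. -/
theorem adjoint_sandwich_domain_le (hL : IsSelfAdjoint L) (hG : IsSelfAdjoint G) :
    (sandwich L G)†.domain ≤ (sandwich L (-G)).domain := by
  intro y hy
  have hd := dense_sandwich_domain hL hG
  obtain ⟨u, hu⟩ := exists_sandwich_add_eq hL hG.neg ((sandwich L G)† ⟨y, hy⟩ + y)
  -- `L (I - i G) L + I` is onto, while its extension `A† + I` is injective.
  have heq : (u : H) = y := by
    rw [← sub_eq_zero, ← inner_self_eq_zero (𝕜 := ℂ)]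
    obtain ⟨v, hv⟩ := exists_sandwich_add_eq hL hG ((u : H) - y)
    obtain ⟨hvL, -⟩ := mem_sandwich_domain.1 v.2
    obtain ⟨huL, -⟩ := mem_sandwich_domain.1 u.2
    have h1 : inner ℂ (u : H) (sandwich L G v) = inner ℂ (sandwich L (-G) u) (v : H) := by
      rw [inner_sandwich hL v hvL ⟨u, huL⟩, ← inner_conj_symm _ (v : H),
        inner_sandwich hL u huL ⟨v, hvL⟩, map_add, map_mul, inner_conj_symm, inner_conj_symm]
      have := hG.isSymmetric (L ⟨u, huL⟩) (L ⟨v, hvL⟩)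
      simp only [ContinuousLinearMap.coe_coe] at this
      simp [inner_neg_left, this]
    have h2 := LinearPMap.adjoint_isFormalAdjoint hd ⟨y, hy⟩ v
    have h3 : sandwich L (-G) u = (sandwich L G)† ⟨y, hy⟩ + y - u := by
      rw [← hu]; simp
    nth_rewrite 2 [← hv]
    simp only [inner_sub_left, inner_sub_right, neg_smul, one_smul, inner_neg_right, h1, ← h2, h3,
      inner_add_left]
    ring
  rw [← heq]
  exact u.2

theorem sandwich_domain_inf_adjoint_domain (h : IsAdmissible L G) :
    (sandwich L G).domain ⊓ (sandwich L G)†.domain = ⊥ := by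
  obtain ⟨hL, hLker, hG, hGker, hrange⟩ := h
  rw [Submodule.eq_bot_iff]
  rintro u ⟨hu1, hu2⟩
  obtain ⟨h, h1⟩ := mem_sandwich_domain.1 hu1
  obtain ⟨_, h2⟩ := mem_sandwich_domain.1 (adjoint_sandwich_domain_le hL hG hu2)
  have hmem : G (L ⟨u, h⟩) ∈ LinearMap.range (G : H →ₗ[ℂ] H) ⊓ L.domain := by
    refine ⟨⟨_, rfl⟩, ?_⟩
    have h3 := L.domain.smul_mem (-(Complex.I / 2)) (L.domain.sub_mem h1 h2)
    change G (L ⟨u, h⟩) ∈ L.domain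
    convert h3 using 1
    simp only [neg_apply, smul_neg, add_sub_add_left_eq_sub, sub_neg_eq_add, ← add_smul, smul_smul]
    rw [show -(Complex.I / 2) * (Complex.I + Complex.I) = 1 by
      linear_combination -Complex.I_mul_I, one_smul]
  rw [hrange] at hmem
  have h0 : L ⟨u, h⟩ = 0 := LinearMap.ker_eq_bot'.1 hGker _ hmem
  exact congrArg Subtype.val (LinearMap.ker_eq_bot'.1 hLker ⟨u, h⟩ h0)

end Sandwich

/-! ### Power series and generalized Vandermonde systems at the nodes `2⁻ⁿ⁻¹` -/

/-- The nodes `2⁻ⁿ⁻¹`. -/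
noncomputable def node (n : ℕ) : ℝ := (1 / 2) ^ (n + 1)

theorem node_pos (n : ℕ) : 0 < node n := by unfold node; positivity

theorem node_le_half (n : ℕ) : node n ≤ 1 / 2 := by
  unfold node
  exact pow_le_of_le_one (by norm_num) (by norm_num) (Nat.succ_ne_zero n)

theorem node_succ (n : ℕ) : node (n + 1) = node n / 2 := by
  unfold node; rw [pow_succ]; ring

theorem node_antitone : Antitone node :=
  antitone_nat_of_succ_le fun n => by rw [node_succ]; linarith [node_pos n]

theorem tendsto_node : Filter.Tendsto node Filter.atTop (nhds 0) :=
  (tendsto_pow_atTop_nhds_zero_of_lt_one (by norm_num) (by norm_num)).comp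
    (Filter.tendsto_add_atTop_nat 1)

theorem summable_node_pow (n : ℕ) : Summable fun m => node n ^ m :=
  summable_geometric_of_lt_one (node_pos n).le ((node_le_half n).trans_lt (by norm_num))

theorem summable_mul_node_pow {y : ℕ → ℂ} {B : ℝ} (hy : ∀ m, ‖y m‖ ≤ B) (n : ℕ) :
    Summable fun m => y m * (node n : ℂ) ^ m := by
  refine Summable.of_norm_bounded ((summable_node_pow n).mul_left B) fun m => ?_
  rw [norm_mul, norm_pow, Complex.norm_real, Real.norm_of_nonneg (node_pos n).le]
  exact mul_le_mul_of_nonneg_right (hy m) (pow_nonneg (node_pos n).le m)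

/-- A power series with bounded coefficients whose values at infinitely many of the nodes decay
faster than every power of the node is zero: its lowest nonzero coefficient would dominate. -/
theorem eq_zero_of_norm_tsum_le {y : ℕ → ℂ} {B C : ℝ} (hy : ∀ m, ‖y m‖ ≤ B)
    (h : ∀ j, ‖∑' m, y m * (node (2 * j) : ℂ) ^ m‖ ≤ C * node (2 * j) ^ (2 * j)) : y = 0 := by
  have hB : 0 ≤ B := (norm_nonneg _).trans (hy 0)
  have hC : 0 ≤ C := nonneg_of_mul_nonneg_left ((norm_nonneg _).trans (h 0))
    (pow_pos (node_pos _) _)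
  funext m
  induction m using Nat.strong_induction_on with
  | _ m ih =>
    have hbound : ∀ j, m + 1 ≤ j → ‖y m‖ ≤ (C + 2 * B) * node (2 * j) := by
      intro j hj
      set z := node (2 * j) with hz
      have hz0 : 0 < z := node_pos _
      have hz2 : z ≤ 1 / 2 := node_le_half _
      have hsum := (summable_mul_node_pow hy (2 * j)).sum_add_tsum_nat_add (m + 1)
      rw [Finset.sum_range_succ, Finset.sum_eq_zero fun l hl => by
        rw [ih l (Finset.mem_range.1 hl)]; simp, zero_add] at hsum
      have htail : ‖∑' i, y (i + (m + 1)) * (z : ℂ) ^ (i + (m + 1))‖ ≤ z ^ m * (2 * B * z) := by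
        refine tsum_of_norm_bounded (g := fun i => (B * z ^ (m + 1)) * (1 / 2 : ℝ) ^ i) ?_ fun i => ?_
        · have := hasSum_geometric_two.mul_left (B * z ^ (m + 1))
          rwa [show B * z ^ (m + 1) * 2 = z ^ m * (2 * B * z) by ring] at this
        · rw [norm_mul, norm_pow, Complex.norm_real, Real.norm_of_nonneg hz0.le, pow_add]
          calc ‖y (i + (m + 1))‖ * (z ^ i * z ^ (m + 1)) ≤ B * ((1 / 2) ^ i * z ^ (m + 1)) := by
                gcongr
                exact hy _
            _ = _ := by ring
      have hval := h j
      rw [← hsum] at hval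
      have h1 : ‖y m‖ * z ^ m ≤ C * z ^ (2 * j) + z ^ m * (2 * B * z) := by
        calc ‖y m‖ * z ^ m = ‖y m * (z : ℂ) ^ m‖ := by
              rw [norm_mul, norm_pow, Complex.norm_real, Real.norm_of_nonneg hz0.le]
          _ ≤ _ := by
              refine (norm_le_add_norm_add _ (∑' i, y (i + (m + 1)) * (z : ℂ) ^ (i + (m + 1)))).trans ?_
              exact add_le_add hval htail
      have h2 : z ^ (2 * j) ≤ z ^ m * z := by
        rw [← pow_succ]
        exact pow_le_pow_of_le_one hz0.le (by linarith) (by omega)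
      have h3 : ‖y m‖ * z ^ m ≤ ((C + 2 * B) * z) * z ^ m := by
        nlinarith [mul_le_mul_of_nonneg_left h2 hC]
      exact le_of_mul_le_mul_right h3 (pow_pos hz0 m)
    have hlim : Filter.Tendsto (fun j => (C + 2 * B) * node (2 * j)) Filter.atTop (nhds 0) := by
      have := (tendsto_node.comp (Filter.tendsto_id.const_mul_atTop' (two_pos (α := ℕ)))).const_mul
        (C + 2 * B)
      simpa using this
    exact norm_le_zero_iff.1 (ge_of_tendsto hlim (Filter.eventually_atTop.2 ⟨m + 1, hbound⟩))

/-- The infinite Vandermonde system at the nodes is injective on `ℓ¹`: as `m` grows, the first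
nonzero coefficient would dominate `∑ aₙ zₙᵐ`. -/
theorem eq_zero_of_tsum_mul_node_pow_eq_zero {a : ℕ → ℂ} (ha : Summable fun n => ‖a n‖)
    (h : ∀ m, ∑' n, a n * (node n : ℂ) ^ m = 0) : a = 0 := by
  have hterm : ∀ n m k, k ≤ n → ‖a n * (node n : ℂ) ^ m‖ ≤ ‖a n‖ * node k ^ m := by
    intro n m k hk
    rw [norm_mul, norm_pow, Complex.norm_real, Real.norm_of_nonneg (node_pos n).le]
    exact mul_le_mul_of_nonneg_left (pow_le_pow_left₀ (node_pos n).le (node_antitone hk) m)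
      (norm_nonneg _)
  have hs : ∀ m, Summable fun n => a n * (node n : ℂ) ^ m := fun m =>
    Summable.of_norm_bounded (ha.mul_right (node 0 ^ m)) fun n => hterm n m 0 (Nat.zero_le n)
  funext n
  induction n using Nat.strong_induction_on with
  | _ n ih =>
    have hbound : ∀ m, ‖a n‖ ≤ (∑' i, ‖a (i + (n + 1))‖) * (1 / 2) ^ m := by
      intro m
      have hz0 := node_pos n
      have hsum := (hs m).sum_add_tsum_nat_add (n + 1)
      rw [Finset.sum_range_succ, Finset.sum_eq_zero fun l hl => by
        rw [ih l (Finset.mem_range.1 hl)]; simp, zero_add, h m, add_eq_zero_iff_eq_neg] at hsum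
      have htail : ‖∑' i, a (i + (n + 1)) * (node (i + (n + 1)) : ℂ) ^ m‖ ≤
          (∑' i, ‖a (i + (n + 1))‖) * node (n + 1) ^ m :=
        tsum_of_norm_bounded (((summable_nat_add_iff (n + 1)).2 ha).hasSum.mul_right _)
          fun i => hterm _ _ _ (Nat.le_add_left _ _)
      rw [← norm_neg, ← hsum, norm_mul, norm_pow, Complex.norm_real, Real.norm_of_nonneg hz0.le,
        node_succ, div_eq_mul_one_div, mul_pow, ← mul_assoc, mul_right_comm] at htail
      exact le_of_mul_le_mul_right htail (pow_pos hz0 m)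
    have hlim : Filter.Tendsto (fun m => (∑' i, ‖a (i + (n + 1))‖) * (1 / 2 : ℝ) ^ m) Filter.atTop
        (nhds 0) := by
      have := (tendsto_pow_atTop_nhds_zero_of_lt_one (r := (1 / 2 : ℝ)) (by norm_num)
        (by norm_num)).const_mul (∑' i, ‖a (i + (n + 1))‖)
      simpa using this
    exact norm_le_zero_iff.1 (ge_of_tendsto' hlim hbound)

/-- The vector `(1, z, z², …)` of `ℓ²`, with `z` the `n`-th node. -/
noncomputable def powerVector (n : ℕ) : lp (fun _ : ℕ => ℂ) 2 :=
  ⟨fun m => (node n : ℂ) ^ m, by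
    refine memℓp_gen ?_
    have : node n ^ 2 < 1 := by nlinarith [node_pos n, node_le_half n]
    refine (summable_geometric_of_lt_one (sq_nonneg (node n)) this).congr fun m => ?_
    rw [norm_pow, Complex.norm_real, Real.norm_of_nonneg (node_pos n).le]
    simp only [ENNReal.toReal_ofNat, Real.rpow_ofNat]
    ring⟩

theorem powerVector_apply (n m : ℕ) : powerVector n m = (node n : ℂ) ^ m := rfl

theorem inner_powerVector (n : ℕ) (y : lp (fun _ : ℕ => ℂ) 2) :
    inner ℂ (powerVector n) y = ∑' m, y m * (node n : ℂ) ^ m := by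
  rw [lp.inner_eq_tsum]
  refine tsum_congr fun m => ?_
  rw [powerVector_apply, RCLike.inner_apply, map_pow, Complex.conj_ofReal]

/-- Weights that make `∑ weight n • powerVector n` absolutely convergent. -/
noncomputable def weight (n : ℕ) : ℝ := (1 / 2) ^ n / (1 + ‖powerVector n‖)

theorem weight_pos (n : ℕ) : 0 < weight n := by unfold weight; positivity

theorem weight_mul_norm_le (n : ℕ) : weight n * ‖powerVector n‖ ≤ (1 / 2) ^ n := by
  rw [weight, div_mul_eq_mul_div, div_le_iff₀ (by positivity)]
  exact mul_le_mul_of_nonneg_left (by linarith) (by positivity)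

theorem weight_le (n : ℕ) : weight n ≤ (1 / 2) ^ n :=
  div_le_self (by positivity) (by linarith [norm_nonneg (powerVector n)])

/-! ### Orthonormal sequences -/

/-- If `T` has small values on unit vectors orthogonal to any given finite-dimensional subspace, then
it decays as fast as desired along some orthonormal sequence. -/
theorem exists_orthonormal_norm_le {T : H →L[ℂ] H}
    (hT : ∀ F : Submodule ℂ H, FiniteDimensional ℂ F → ∀ ε : ℝ, 0 < ε →
      ∃ x ∈ Fᗮ, ‖x‖ = 1 ∧ ‖T x‖ ≤ ε) {δ : ℕ → ℝ} (hδ : ∀ n, 0 < δ n) :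
    ∃ f : ℕ → H, Orthonormal ℂ f ∧ ∀ n, ‖T (f n)‖ ≤ δ n := by
  -- Vectors are chosen together with strictly increasing labels that keep track of the bounds.
  obtain ⟨g, hg1, hg2⟩ := exists_seq_of_forall_finset_exists
    (fun p : ℕ × H => ‖p.2‖ = 1 ∧ ∀ k ≤ p.1, ‖T p.2‖ ≤ δ k)
    (fun p q => p.1 < q.1 ∧ inner ℂ p.2 q.2 = 0) fun s _ => by
      classical
      set N := s.sup Prod.fst + 1
      obtain ⟨k, -, hk⟩ := Finset.exists_min_image (Finset.range (N + 1)) δ ⟨0, by simp⟩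
      obtain ⟨x, hx, hx1, hx2⟩ := hT (Submodule.span ℂ (s.image Prod.snd : Finset H))
        inferInstance (δ k) (hδ k)
      refine ⟨(N, x), ⟨hx1, fun l hl => ?_⟩, fun p hp => ⟨Nat.lt_succ_of_le (Finset.le_sup hp), ?_⟩⟩
      · exact hx2.trans (hk l (Finset.mem_range.2 (Nat.lt_succ_of_le hl)))
      exact (Submodule.mem_orthogonal _ _).1 hx _
        (Submodule.subset_span (Finset.mem_coe.2 (Finset.mem_image_of_mem _ hp)))
  have hmono : StrictMono fun n => (g n).1 := fun m n hmn => (hg2 m n hmn).1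
  refine ⟨fun n => (g n).2, ⟨fun n => (hg1 n).1, fun m n hmn => ?_⟩,
    fun n => (hg1 n).2 n hmono.le_apply⟩
  rcases lt_or_gt_of_ne hmn with h | h
  · exact (hg2 m n h).2
  · exact inner_eq_zero_symm.1 (hg2 n m h).2

/-- A bounded injective operator that is not bounded below is not bounded below on any closed subspace
of finite codimension either. -/
theorem exists_mem_orthogonal_norm_le [CompleteSpace H] {T : H →L[ℂ] H}
    (hinj : Function.Injective T) (hT : ¬ ∃ C : ℝ, ∀ x, ‖x‖ ≤ C * ‖T x‖) (F : Submodule ℂ H)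
    (hF : FiniteDimensional ℂ F) (ε : ℝ) (hε : 0 < ε) : ∃ x ∈ Fᗮ, ‖x‖ = 1 ∧ ‖T x‖ ≤ ε := by
  by_contra! hcon
  have hbelow : ∀ x : Fᗮ, ‖x‖ ≤ ε⁻¹ * ‖(T ∘L Fᗮ.subtypeL) x‖ := by
    intro x
    by_cases hx : x = 0
    · simp [hx]
    have hn : 0 < ‖(x : H)‖ := norm_pos_iff.2 fun h => hx (Subtype.ext h)
    have h := hcon (((‖(x : H)‖⁻¹ : ℝ) : ℂ) • (x : H)) (Fᗮ.smul_mem _ x.2)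
      (by simp [norm_smul, hn.ne'])
    rw [map_smul, norm_smul, Complex.norm_real, norm_inv, norm_norm, inv_mul_eq_div,
      lt_div_iff₀ hn] at h
    rw [inv_mul_eq_div, le_div_iff₀ hε, mul_comm]
    exact h.le
  have hanti : AntilipschitzWith ⟨ε⁻¹, by positivity⟩ (T ∘L Fᗮ.subtypeL) :=
    ContinuousLinearMap.antilipschitz_of_bound _ hbelow
  have hcl : IsClosed ((Fᗮ.map (T : H →ₗ[ℂ] H) : Submodule ℂ H) : Set H) := by
    have := hanti.isClosed_range (T ∘L Fᗮ.subtypeL).uniformContinuous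
    convert this using 1
    ext y
    simp
  have hcl' : IsClosed (Set.range T) := by
    have h := Submodule.isClosed_sup_finiteDimensional _ (F.map (T : H →ₗ[ℂ] H)) hcl
    rw [← Submodule.map_sup, sup_comm, Submodule.sup_orthogonal_of_hasOrthogonalProjection,
      Submodule.map_top] at h
    exact h
  obtain ⟨K, hK⟩ := T.antilipschitz_of_injective_of_isClosed_range hinj hcl'
  exact hT ⟨K, fun x => hK.le_mul_norm (map_zero T) x⟩

theorem exists_mem_orthogonal_norm_eq_one (hH : ¬ FiniteDimensional ℂ H) (F : Submodule ℂ H)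
    (hF : FiniteDimensional ℂ F) : ∃ x ∈ Fᗮ, ‖x‖ = 1 := by
  have hne : Fᗮ ≠ ⊥ := fun h => hH <| by
    rw [Submodule.orthogonal_eq_bot_iff] at h
    subst h
    exact Module.Finite.equiv (Submodule.topEquiv (R := ℂ) (M := H))
  obtain ⟨x, hx, hx0⟩ := Submodule.exists_mem_ne_zero_of_ne_bot hne
  exact ⟨((‖x‖⁻¹ : ℝ) : ℂ) • x, Fᗮ.smul_mem _ hx, by simp [norm_smul, hx0]⟩

theorem exists_orthonormal_nat (hH : ¬ FiniteDimensional ℂ H) : ∃ f : ℕ → H, Orthonormal ℂ f := by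
  obtain ⟨f, hf, -⟩ := exists_orthonormal_norm_le (T := (0 : H →L[ℂ] H)) (fun F hF ε hε => by
    obtain ⟨x, hx, hx1⟩ := exists_mem_orthogonal_norm_eq_one hH F hF
    exact ⟨x, hx, hx1, by simpa using hε.le⟩) (δ := fun _ => 1) fun _ => one_pos
  exact ⟨f, hf⟩

/-- A sequence of vectors of norm at most `1`, total in `H`. -/
theorem exists_total_seq (H : Type*) [NormedAddCommGroup H] [InnerProductSpace ℂ H]
    [TopologicalSpace.SeparableSpace H] :
    ∃ d : ℕ → H, (∀ n, ‖d n‖ ≤ 1) ∧ ∀ x, (∀ n, inner ℂ (d n) x = 0) → x = 0 := by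
  have hd : ∀ x : H, ‖(((1 + ‖x‖)⁻¹ : ℝ) : ℂ) • x‖ ≤ 1 := fun x => by
    rw [norm_smul, Complex.norm_real, Real.norm_of_nonneg (by positivity), inv_mul_eq_div]
    exact div_le_one_of_le₀ (by linarith) (by positivity)
  refine ⟨fun n => (((1 + ‖TopologicalSpace.denseSeq H n‖)⁻¹ : ℝ) : ℂ) •
    TopologicalSpace.denseSeq H n, fun n => hd _, fun x hx => ?_⟩
  refine (TopologicalSpace.denseRange_denseSeq H).induction_on (p := fun y => inner ℂ y x = 0) x
    (isClosed_eq (by fun_prop) continuous_const) (fun n => ?_) |> inner_self_eq_zero.1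
  have h := hx n
  rw [inner_smul_left, mul_eq_zero] at h
  refine h.resolve_left ?_
  rw [Complex.conj_ofReal]
  exact Complex.ofReal_ne_zero.2 (by positivity)

/-- The operator `∑ (β n, ·) v n`, a norm convergent series of operators of rank one. -/
theorem exists_clm_hasSum {E : Type*} [NormedAddCommGroup E] [NormedSpace ℂ E] [CompleteSpace E]
    {β : ℕ → H} (hβ : ∀ n, ‖β n‖ ≤ 1) {v : ℕ → E} (hv : Summable fun n => ‖v n‖) :
    ∃ Q : H →L[ℂ] E, (∀ x, HasSum (fun n => inner ℂ (β n) x • v n) (Q x)) ∧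
      IsCompactOperator Q := by
  obtain ⟨Q, hQ⟩ : Summable fun n => (innerSL ℂ (β n)).smulRight (v n) := by
    refine Summable.of_norm_bounded hv fun n => ?_
    rw [ContinuousLinearMap.norm_smulRight_apply, innerSL_apply_norm]
    exact mul_le_of_le_one_left (norm_nonneg _) (hβ n)
  refine ⟨Q, fun x => ?_, ?_⟩
  · have h := (ContinuousLinearMap.apply ℂ E x).hasSum hQ
    simpa using h
  · refine isCompactOperator_of_tendsto hQ (Filter.Eventually.of_forall fun s => ?_)
    exact Submodule.sum_mem (compactOperator (RingHom.id ℂ) H E) fun n _ =>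
      (isCompactOperator_of_locallyCompactSpace_dom (innerSL ℂ (β n))).clm_comp
        (ContinuousLinearMap.toSpanSingleton ℂ (v n))

/-! ### A bounded operator whose range avoids the domain of a given selfadjoint operator -/

/-- A total sequence `β` of vectors of norm at most `1` gives an injective operator `Q` from `H` to
`ℓ²` that sends each unit vector `β j` orthogonal to the others to a multiple of `powerVector j`. -/
theorem exists_injective_clm {β : ℕ → H} (hβ : ∀ n, ‖β n‖ ≤ 1)
    (htot : ∀ x, (∀ n, inner ℂ (β n) x = 0) → x = 0) :
    ∃ Q : H →L[ℂ] lp (fun _ : ℕ => ℂ) 2, (∀ x, Q x = 0 → x = 0) ∧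
      ∀ j, ‖β j‖ = 1 → (∀ n, n ≠ j → inner ℂ (β n) (β j) = 0) →
        Q (β j) = (weight j : ℂ) • powerVector j := by
  obtain ⟨Q, hQ, -⟩ := exists_clm_hasSum hβ (v := fun n => (weight n : ℂ) • powerVector n) <| by
    refine Summable.of_nonneg_of_le (fun _ => norm_nonneg _) (fun n => ?_) summable_geometric_two
    rw [norm_smul, Complex.norm_real, Real.norm_of_nonneg (weight_pos n).le]
    exact weight_mul_norm_le n
  refine ⟨Q, fun x hx => ?_, fun j hj hort => ?_⟩
  · let a : ℕ → ℂ := fun n => inner ℂ (β n) x * weight n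
    have ha : Summable fun n => ‖a n‖ := by
      refine Summable.of_nonneg_of_le (fun _ => norm_nonneg _) (fun n => ?_)
        (summable_geometric_two.mul_left ‖x‖)
      rw [norm_mul, Complex.norm_real, Real.norm_of_nonneg (weight_pos n).le]
      refine mul_le_mul ((norm_inner_le_norm _ _).trans ?_) (weight_le n) (weight_pos n).le
        (norm_nonneg _)
      exact mul_le_of_le_one_left (norm_nonneg _) (hβ n)
    have h0 : a = 0 := eq_zero_of_tsum_mul_node_pow_eq_zero ha fun m => by
      have h := (lp.evalCLM ℂ (fun _ : ℕ => ℂ) 2 m).hasSum (hQ x)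
      rw [hx, map_zero] at h
      rw [← h.tsum_eq]
      refine tsum_congr fun n => ?_
      rw [map_smul, map_smul]
      change inner ℂ (β n) x * weight n * _ = inner ℂ (β n) x * (weight n * powerVector n m)
      rw [powerVector_apply, mul_assoc]
    refine htot x fun n => ?_
    have h := congrFun h0 n
    exact (mul_eq_zero.1 h).resolve_right (Complex.ofReal_ne_zero.2 (weight_pos n).ne')
  · refine (hQ (β j)).unique ?_
    have h := hasSum_single (f := fun n => inner ℂ (β n) (β j) • (weight n : ℂ) • powerVector n) j
      fun n hn => by rw [hort n hn, zero_smul]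
    simpa only [inner_self_eq_norm_sq_to_K, hj, RCLike.ofReal_one, one_pow, one_smul] using h

/-- An orthonormal sequence `f` can be completed by a sequence `e`, orthogonal to it, to a total
family. -/
theorem exists_total_seq_orthogonal [CompleteSpace H] [TopologicalSpace.SeparableSpace H]
    (f : ℕ → H) : ∃ e : ℕ → H, (∀ n, ‖e n‖ ≤ 1) ∧ (∀ m n, inner ℂ (e m) (f n) = 0) ∧
      ∀ x, (∀ n, inner ℂ (f n) x = 0) → (∀ n, inner ℂ (e n) x = 0) → x = 0 := by
  obtain ⟨d, hd1, hd2⟩ := exists_total_seq H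
  let V : Submodule ℂ H := (Submodule.span ℂ (Set.range f))ᗮ
  refine ⟨fun n => V.starProjection (d n), fun n => ?_, fun m n => ?_, fun x hf he => hd2 x ?_⟩
  · exact (V.norm_starProjection_apply_le _).trans (hd1 n)
  · exact (Submodule.mem_orthogonal' _ _).1 (V.starProjection_apply_mem (d m)) _
      (Submodule.subset_span ⟨n, rfl⟩)
  · intro n
    have hx : x ∈ V := by
      rw [Submodule.mem_orthogonal]
      intro u hu
      induction hu using Submodule.span_induction with
      | mem u hu => obtain ⟨n, rfl⟩ := hu; exact hf n
      | zero => simp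
      | add u v _ _ hu hv => rw [inner_add_left, hu, hv, add_zero]
      | smul c u _ hu => rw [inner_smul_left, hu, mul_zero]
    rw [← Submodule.starProjection_eq_self_iff.2 hx, ← Submodule.inner_starProjection_left_eq_right]
    exact he n

/-- Given an unbounded selfadjoint `L`, there are orthonormal vectors `fₙ` with `(L - i)⁻¹ fₙ` as
small as desired, so the coefficients `(fₙ, y)` decay fast for all `y` in `dom L`. The operator
`G = Q* Q` is built so that for `x ≠ 0` the coefficients `(fₙ, G x)` are, up to weights, the values
of a nonzero power series at the nodes, which do not decay that fast. -/
theorem exists_isAdmissible [CompleteSpace H] [TopologicalSpace.SeparableSpace H]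
    {L : H →ₗ.[ℂ] H} (hL : IsSelfAdjoint L) (hunb : IsUnbounded L)
    (hker : LinearMap.ker L.toFun = ⊥) : ∃ G : H →L[ℂ] H, IsAdmissible L G := by
  obtain ⟨R, hR1, hR2⟩ := exists_isResolventAt_of_isSelfAdjoint hL (z := Complex.I) (Or.inl rfl)
  have hinj : Function.Injective R := by
    rw [injective_iff_map_eq_zero]
    intro x hx
    obtain ⟨h, h'⟩ := hR2 x
    have : (⟨R x, h⟩ : L.domain) = 0 := Subtype.ext hx
    rw [← h', this, hx]
    simp
  have hnb : ¬ ∃ C : ℝ, ∀ x, ‖x‖ ≤ C * ‖R x‖ := by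
    rintro ⟨C, hC⟩
    refine hunb ⟨C + 1, fun u => ?_⟩
    have h := hC (L u - Complex.I • (u : H))
    rw [hR1] at h
    calc ‖L u‖ = ‖(L u - Complex.I • (u : H)) + Complex.I • (u : H)‖ := by rw [sub_add_cancel]
      _ ≤ C * ‖(u : H)‖ + ‖(u : H)‖ := (norm_add_le _ _).trans (add_le_add h (by simp [norm_smul]))
      _ = (C + 1) * ‖(u : H)‖ := by ring
  obtain ⟨f, hf, hfR⟩ := exists_orthonormal_norm_le (exists_mem_orthogonal_norm_le hinj hnb)
    (δ := fun j => weight (2 * j) * node (2 * j) ^ (2 * j))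
    fun j => mul_pos (weight_pos _) (pow_pos (node_pos _) _)
  obtain ⟨e, he1, hef, htot⟩ := exists_total_seq_orthogonal f
  let β : ℕ → H := fun n => if Even n then f (n / 2) else e (n / 2)
  have hβe : ∀ j, β (2 * j) = f j := fun j => by simp [β]
  have hβo : ∀ j, β (2 * j + 1) = e j := fun j => by
    simp [β, Nat.mul_add_div]
  obtain ⟨Q, hQ, hQβ⟩ := exists_injective_clm (β := β)
    (fun n => by
      rcases Nat.even_or_odd' n with ⟨k, rfl | rfl⟩
      · rw [hβe, hf.1]
      · rw [hβo]; exact he1 k)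
    fun x hx => htot x (fun n => by rw [← hβe]; exact hx _) fun n => by rw [← hβo]; exact hx _
  have hQf : ∀ j, Q (f j) = (weight (2 * j) : ℂ) • powerVector (2 * j) := fun j => by
    rw [← hβe]
    refine hQβ _ (by rw [hβe, hf.1]) fun n hn => ?_
    rw [hβe]
    rcases Nat.even_or_odd' n with ⟨k, rfl | rfl⟩
    · rw [hβe]; exact hf.2 fun h => hn (by rw [h])
    · rw [hβo]; exact hef k j
  have key : ∀ x, (Q.adjoint ∘L Q) x ∈ L.domain → x = 0 := by
    intro x hx
    set w := L ⟨_, hx⟩ + Complex.I • (Q.adjoint ∘L Q) x with hw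
    refine hQ x (lp.ext ?_)
    refine eq_zero_of_norm_tsum_le (B := ‖Q x‖) (C := ‖w‖)
      (fun m => lp.norm_apply_le_norm two_ne_zero _ m) fun j => ?_
    have h1 : inner ℂ (f j) ((Q.adjoint ∘L Q) x) = inner ℂ (R (f j)) w := by
      obtain ⟨h, h'⟩ := hR2 (f j)
      rw [hw, inner_add_right, ← inner_apply_comm hL ⟨R (f j), h⟩ ⟨_, hx⟩, inner_smul_right]
      nth_rewrite 1 [← h']
      rw [inner_sub_left, inner_smul_left, Complex.conj_I]
      simp
    rw [ContinuousLinearMap.comp_apply, ContinuousLinearMap.adjoint_inner_right, hQf,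
      inner_smul_left, Complex.conj_ofReal, inner_powerVector] at h1
    have h2 := (norm_inner_le_norm (𝕜 := ℂ) (R (f j)) w).trans
      (mul_le_mul_of_nonneg_right (hfR j) (norm_nonneg w))
    rw [← h1, norm_mul, Complex.norm_real, Real.norm_of_nonneg (weight_pos _).le, mul_assoc] at h2
    rw [mul_comm ‖w‖]
    exact le_of_mul_le_mul_left h2 (weight_pos _)
  refine ⟨Q.adjoint ∘L Q, hL, hker, ?_, ?_, ?_⟩
  · rw [ContinuousLinearMap.isSelfAdjoint_iff', ContinuousLinearMap.adjoint_comp,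
      ContinuousLinearMap.adjoint_adjoint]
  · rw [LinearMap.ker_eq_bot']
    exact fun x hx => key x (by
      have : (Q.adjoint ∘L Q) x = 0 := hx
      rw [this]; exact L.domain.zero_mem)
  · rw [Submodule.eq_bot_iff]
    rintro _ ⟨⟨x, rfl⟩, hx⟩
    rw [key x hx, map_zero]

/-! ### Compact operators and inverses of bounded operators -/

theorem isUnbounded_of_inverse {L : H →ₗ.[ℂ] H} {D : H →L[ℂ] H}
    (hLD : ∀ x, ∃ h : D x ∈ L.domain, L ⟨D x, h⟩ = x)
    (hD : ∀ c : ℝ, 0 < c → ∃ x, ‖x‖ = 1 ∧ ‖D x‖ < c) : IsUnbounded L := by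
  rintro ⟨C, hC⟩
  obtain ⟨x, hx, hx'⟩ := hD (1 / (|C| + 1)) (by positivity)
  obtain ⟨h, h'⟩ := hLD x
  have h1 := hC ⟨D x, h⟩
  rw [h', hx] at h1
  rw [lt_div_iff₀ (by positivity)] at hx'
  nlinarith [le_abs_self C, norm_nonneg (D x)]

section Complete

variable [CompleteSpace H]

theorem exists_norm_lt_of_isCompactOperator {K : H →L[ℂ] H} (hK : IsCompactOperator K) {e : ℕ → H}
    (he : Orthonormal ℂ e) {c : ℝ} (hc : 0 < c) : ∃ n, ‖K (e n)‖ < c := by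
  by_contra! hcon
  obtain ⟨S, hS, hKS⟩ := hK.image_closedBall_subset_compact (f := (K : H →ₗ[ℂ] H)) 1
  obtain ⟨y, -, φ, hφ, hy⟩ := hS.tendsto_subseq (x := fun n => K (e n)) fun n =>
    hKS ⟨e n, by simp [he.1 n], rfl⟩
  have hweak : ∀ x, Filter.Tendsto (fun n => inner ℂ (e n) x) Filter.atTop (nhds 0) := fun x => by
    have h := (he.inner_products_summable x).tendsto_atTop_zero
    rw [tendsto_zero_iff_norm_tendsto_zero]
    have h' := h.sqrt
    simpa only [Real.sqrt_sq (norm_nonneg _), Real.sqrt_zero] using h'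
  have hy0 : y = 0 := by
    rw [← inner_self_eq_zero (𝕜 := ℂ)]
    refine tendsto_nhds_unique (hy.inner tendsto_const_nhds) ?_
    refine ((hweak (K.adjoint y)).comp hφ.tendsto_atTop).congr fun n => ?_
    simp only [Function.comp_apply, ContinuousLinearMap.adjoint_inner_right]
  have h0 := ge_of_tendsto' hy.norm fun n => hcon (φ n)
  rw [hy0, norm_zero] at h0
  linarith

/-- The inverse of a bounded injective selfadjoint operator is selfadjoint. -/
theorem exists_isSelfAdjoint_inverse {D : H →L[ℂ] H} (hD : IsSelfAdjoint D)
    (hinj : ∀ x, D x = 0 → x = 0) :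
    ∃ L : H →ₗ.[ℂ] H, IsSelfAdjoint L ∧ LinearMap.ker L.toFun = ⊥ ∧
      (∀ u : L.domain, D (L u) = u) ∧ ∀ x, ∃ h : D x ∈ L.domain, L ⟨D x, h⟩ = x := by
  have hinj' : Function.Injective (D : H →ₗ[ℂ] H) := (injective_iff_map_eq_zero _).2 hinj
  let e := LinearEquiv.ofInjective (D : H →ₗ[ℂ] H) hinj'
  let L : H →ₗ.[ℂ] H := ⟨LinearMap.range (D : H →ₗ[ℂ] H), e.symm.toLinearMap⟩
  have h1 : ∀ u : L.domain, D (L u) = u := fun u => congrArg Subtype.val (e.apply_symm_apply u)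
  have h2 : ∀ x, ∃ h : D x ∈ L.domain, L ⟨D x, h⟩ = x := fun x => ⟨⟨x, rfl⟩, e.symm_apply_apply x⟩
  have hsymm : ∀ x y, inner ℂ (D x) y = inner ℂ x (D y) := hD.isSymmetric
  have hdense : Dense (L.domain : Set H) := by
    rw [Submodule.dense_iff_topologicalClosure_eq_top, Submodule.topologicalClosure_eq_top_iff,
      Submodule.eq_bot_iff]
    intro x hx
    refine hinj x ?_
    rw [← inner_self_eq_zero (𝕜 := ℂ), hsymm, ← inner_eq_zero_symm]
    exact (Submodule.mem_orthogonal _ _).1 hx _ (h2 _).1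
  refine ⟨L, ?_, LinearMap.ker_eq_bot.2 e.symm.injective, h1, h2⟩
  rw [LinearPMap.isSelfAdjoint_def]
  refine (LinearPMap.eq_of_le_of_domain_eq (LinearPMap.IsFormalAdjoint.le_adjoint hdense
    fun u v => ?_) (le_antisymm (LinearPMap.IsFormalAdjoint.le_adjoint hdense
    fun u v => ?_).1 fun y hy => ?_)).symm
  · rw [← h1 v, ← hsymm, h1 u]
  · rw [← h1 v, ← hsymm, h1 u]
  · have : D (L† ⟨y, hy⟩) = y := by
      refine ext_inner_right ℂ fun x => ?_
      obtain ⟨h, h'⟩ := h2 x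
      rw [hsymm]
      exact (LinearPMap.adjoint_isFormalAdjoint hdense ⟨y, hy⟩ ⟨D x, h⟩).trans (by rw [h'])
    rw [← this]
    exact (h2 _).1

variable (H) in
/-- A compact positive definite operator, the sum of the rank one operators `2⁻ⁿ (dₙ, ·) dₙ` for a
total bounded sequence `dₙ`. -/
theorem exists_isCompactOperator_posDef [TopologicalSpace.SeparableSpace H] :
    ∃ D : H →L[ℂ] H, IsCompactOperator D ∧ IsSelfAdjoint D ∧ ∀ x, inner ℂ x (D x) = 0 → x = 0 := by
  obtain ⟨d, hd1, hd2⟩ := exists_total_seq H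
  obtain ⟨D, hD, hDc⟩ := exists_clm_hasSum hd1 (v := fun n => (((1 / 2) ^ n : ℝ) : ℂ) • d n) <| by
    refine Summable.of_nonneg_of_le (fun _ => norm_nonneg _) (fun n => ?_) summable_geometric_two
    rw [norm_smul, Complex.norm_real, Real.norm_of_nonneg (by positivity)]
    exact mul_le_of_le_one_right (by positivity) (hd1 n)
  have hinner : ∀ x y, HasSum (fun n => (((1 / 2) ^ n : ℝ) : ℂ) * (inner ℂ x (d n) *
      inner ℂ (d n) y)) (inner ℂ x (D y)) := fun x y => by
    refine (congrArg (HasSum · _) (funext fun n => ?_)).mp ((innerSL ℂ x).hasSum (hD y))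
    rw [innerSL_apply_apply, inner_smul_right, inner_smul_right]
    ring
  refine ⟨D, hDc, ?_, fun x hx => hd2 x fun n => ?_⟩
  · rw [ContinuousLinearMap.isSelfAdjoint_iff_isSymmetric]
    intro x y
    refine HasSum.unique (f := fun n => (((1 / 2) ^ n : ℝ) : ℂ) * (inner ℂ x (d n) *
      inner ℂ (d n) y)) ?_ (hinner x y)
    have h := Complex.hasSum_conj'.2 (hinner y x)
    rw [inner_conj_symm] at h
    refine (congrArg (HasSum · _) (funext fun n => ?_)).mp h
    rw [map_mul, map_mul, inner_conj_symm, inner_conj_symm, Complex.conj_ofReal,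
      mul_comm (inner ℂ (d n) y)]
  · have h := hinner x x
    have hre : HasSum (fun n => (1 / 2 : ℝ) ^ n * ‖inner ℂ (d n) x‖ ^ 2) 0 := by
      rw [hx] at h
      refine (congrArg (HasSum · _) (funext fun n => ?_)).mp (Complex.hasSum_re h)
      rw [Complex.re_ofReal_mul, ← inner_conj_symm x, ← Complex.normSq_eq_conj_mul_self,
        Complex.normSq_eq_norm_sq, Complex.ofReal_re]
    have h0 := congrFun ((hasSum_zero_iff_of_nonneg fun n => by positivity).1 hre) n
    simpa using h0

/-! ### Compactness of the resolvent of `L (I + i G) L` -/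

variable {L : H →ₗ.[ℂ] H} {G : H →L[ℂ] H}

/-- If `L` has a compact inverse `D`, then `(A + I)⁻¹ = D (L (A + I)⁻¹)` with a bounded second
factor. -/
theorem hasCompactResolvent_sandwich (hL : IsSelfAdjoint L) (hG : IsSelfAdjoint G)
    {D : H →L[ℂ] H} (hD : IsCompactOperator D) (hDL : ∀ u : L.domain, D (L u) = u) :
    HasCompactResolvent (sandwich L G) := by
  obtain ⟨K, hK⟩ := exists_isResolventAt_sandwich hL hG
  refine ⟨-1, K, hK, ?_⟩
  have hmem : ∀ f, K f ∈ L.domain := fun f => (mem_sandwich_domain.1 (hK.2 f).1).1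
  let X : H →L[ℂ] H := (L.toFun ∘ₗ (K : H →ₗ[ℂ] H).codRestrict L.domain hmem).mkContinuous 1
    fun f => by
      obtain ⟨h, h'⟩ := hK.2 f
      have h1 := (norm_sq_add_norm_sq_le hL hG ⟨K f, h⟩ (hmem f)).trans (norm_inner_le_norm _ _)
      have h2 := norm_le_norm_sandwich_add hL hG ⟨K f, h⟩
      rw [h'] at h1 h2
      change ‖L ⟨K f, hmem f⟩‖ ≤ _
      change ‖L ⟨K f, hmem f⟩‖ ^ 2 + ‖K f‖ ^ 2 ≤ ‖K f‖ * ‖f‖ at h1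
      rw [one_mul]
      refine le_of_sq_le_sq ?_ (norm_nonneg _)
      change ‖K f‖ ≤ ‖f‖ at h2
      nlinarith [norm_nonneg (K f), norm_nonneg f]
  have : K = D ∘L X := by
    ext f
    exact (hDL ⟨K f, hmem f⟩).symm
  rw [this]
  exact hD.comp_clm X

/-- If `L` fixes an orthonormal sequence `eₙ`, then `(A + I)⁻¹ eₙ` stays away from zero: pairing
`(A + I) u = eₙ` with `eₙ` shows that `‖L u‖ + ‖u‖` is bounded below, while
`‖L u‖² + ‖u‖² = Re (eₙ, u)`. -/
theorem not_hasCompactResolvent_sandwich (hL : IsSelfAdjoint L) (hG : IsSelfAdjoint G)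
    {e : ℕ → H} (he : Orthonormal ℂ e) (hLe : ∀ n, ∃ h : e n ∈ L.domain, L ⟨e n, h⟩ = e n) :
    ¬ HasCompactResolvent (sandwich L G) := by
  rintro ⟨z, R, hR, hRc⟩
  obtain ⟨K, hK⟩ := exists_isResolventAt_sandwich hL hG
  set c : ℝ := 1 / (2 + ‖G‖) with hc
  have hc0 : 0 < c := by positivity
  obtain ⟨n, hn⟩ := exists_norm_lt_of_isCompactOperator (hR.isCompactOperator hK hRc) he
    (pow_pos hc0 2)
  obtain ⟨hu, hf⟩ := hK.2 (e n)
  obtain ⟨huL, -⟩ := mem_sandwich_domain.1 hu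
  obtain ⟨heL, hLe⟩ := hLe n
  have h1 := (norm_sq_add_norm_sq_le hL hG ⟨K (e n), hu⟩ huL).trans (norm_inner_le_norm _ _)
  rw [hf, he.1 n, mul_one] at h1
  change ‖L ⟨K (e n), huL⟩‖ ^ 2 + ‖K (e n)‖ ^ 2 ≤ ‖K (e n)‖ at h1
  have h2 : (1 : ℂ) = inner ℂ (e n) (L ⟨K (e n), huL⟩) +
      Complex.I * inner ℂ (e n) (G (L ⟨K (e n), huL⟩)) + inner ℂ (e n) (K (e n)) := by
    have h := inner_sandwich hL (G := G) ⟨K (e n), hu⟩ huL ⟨e n, heL⟩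
    rw [hLe, sub_eq_iff_eq_add.1 hf, inner_add_right, neg_one_smul, inner_neg_right,
      inner_self_eq_norm_sq_to_K, he.1 n] at h
    rw [← h]
    simp
  have h3 : 1 ≤ ‖L ⟨K (e n), huL⟩‖ + ‖G‖ * ‖L ⟨K (e n), huL⟩‖ + ‖K (e n)‖ := by
    have h := congrArg norm h2
    rw [norm_one] at h
    rw [h]
    have hb : ∀ x, ‖inner ℂ (e n) x‖ ≤ ‖x‖ := fun x => by
      simpa [he.1 n] using norm_inner_le_norm (𝕜 := ℂ) (e n) x
    refine (norm_add₃_le).trans (add_le_add_three (hb _) ?_ (hb _))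
    rw [norm_mul, Complex.norm_I, one_mul]
    exact (hb _).trans (G.le_opNorm _)
  have h4 : ‖L ⟨K (e n), huL⟩‖ < c := lt_of_pow_lt_pow_left₀ 2 hc0.le (by
    nlinarith [sq_nonneg ‖K (e n)‖])
  have h5 : c * (2 + ‖G‖) = 1 := by rw [hc]; field_simp
  have h6 : c ≤ 1 := by nlinarith [norm_nonneg G]
  nlinarith [norm_nonneg G]

variable [TopologicalSpace.SeparableSpace H]

theorem exists_inverse_isCompactOperator (hH : ¬ FiniteDimensional ℂ H) :
    ∃ (L : H →ₗ.[ℂ] H) (D : H →L[ℂ] H), IsSelfAdjoint L ∧ LinearMap.ker L.toFun = ⊥ ∧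
      IsUnbounded L ∧ IsCompactOperator D ∧ ∀ u : L.domain, D (L u) = u := by
  obtain ⟨e, he⟩ := exists_orthonormal_nat hH
  obtain ⟨D, hDc, hDs, hDpos⟩ := exists_isCompactOperator_posDef H
  obtain ⟨L, hL, hker, hDL, hLD⟩ := exists_isSelfAdjoint_inverse hDs fun x hx =>
    hDpos x (by rw [hx, inner_zero_right])
  refine ⟨L, D, hL, hker, isUnbounded_of_inverse hLD fun c hc => ?_, hDc, hDL⟩
  obtain ⟨n, hn⟩ := exists_norm_lt_of_isCompactOperator hDc he hc
  exact ⟨e n, he.1 n, hn⟩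

/-- The inverse of `(I - P) + P D P`, with `D` compact and positive definite and `P` the projection
onto the orthogonal complement of half of an orthonormal sequence, is unbounded and fixes that half. -/
theorem exists_isUnbounded_fixing_orthonormal (hH : ¬ FiniteDimensional ℂ H) :
    ∃ (L : H →ₗ.[ℂ] H) (e : ℕ → H), IsSelfAdjoint L ∧ LinearMap.ker L.toFun = ⊥ ∧
      IsUnbounded L ∧ Orthonormal ℂ e ∧ ∀ n, ∃ h : e n ∈ L.domain, L ⟨e n, h⟩ = e n := by
  obtain ⟨f, hf⟩ := exists_orthonormal_nat hH
  obtain ⟨D, hDc, hDs, hDpos⟩ := exists_isCompactOperator_posDef H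
  let V : Submodule ℂ H := (Submodule.span ℂ (Set.range fun n => f (2 * n)))ᗮ
  set P := V.starProjection with hPdef
  have hPs : IsSelfAdjoint P := isSelfAdjoint_starProjection V
  have hPsymm : ∀ x y, inner ℂ (P x) y = inner ℂ x (P y) := hPs.isSymmetric
  have hPP : ∀ x, P (P x) = P x := fun x =>
    Submodule.starProjection_eq_self_iff.2 (V.starProjection_apply_mem x)
  have hPeven : ∀ n, P (f (2 * n)) = 0 := fun n => by
    rw [← inner_self_eq_zero (𝕜 := ℂ), hPsymm, hPP]
    exact (Submodule.mem_orthogonal _ _).1 (V.starProjection_apply_mem _) _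
      (Submodule.subset_span ⟨n, rfl⟩)
  have hPodd : ∀ n, P (f (2 * n + 1)) = f (2 * n + 1) := fun n => by
    refine Submodule.starProjection_eq_self_iff.2 ?_
    rw [Submodule.mem_orthogonal]
    intro u hu
    induction hu using Submodule.span_induction with
    | mem u hu => obtain ⟨m, rfl⟩ := hu; exact hf.2 (by omega)
    | zero => simp
    | add u v _ _ hu hv => rw [inner_add_left, hu, hv, add_zero]
    | smul c u _ hu => rw [inner_smul_left, hu, mul_zero]
  let B : H →L[ℂ] H := (1 - P) + P ∘L D ∘L P
  have hB : ∀ x, B x = x - P x + P (D (P x)) := fun x => rfl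
  have hBs : IsSelfAdjoint B := by
    rw [ContinuousLinearMap.isSelfAdjoint_iff_isSymmetric]
    intro x y
    have hDsymm : ∀ x y, inner ℂ (D x) y = inner ℂ x (D y) := hDs.isSymmetric
    simp only [ContinuousLinearMap.coe_coe, hB, inner_add_left, inner_add_right, inner_sub_left,
      inner_sub_right, hPsymm, hDsymm]
  have hBinj : ∀ x, B x = 0 → x = 0 := fun x hx => by
    have h1 : P (D (P x)) = 0 := by
      have h := congrArg P hx
      rwa [hB, map_add, map_sub, hPP, hPP, sub_self, zero_add, map_zero] at h
    have h2 : P x = 0 := hDpos _ (by rw [hPsymm, h1, inner_zero_right])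
    rwa [hB, h1, h2, sub_zero, add_zero] at hx
  obtain ⟨L, hL, hker, -, hLB⟩ := exists_isSelfAdjoint_inverse hBs hBinj
  refine ⟨L, fun n => f (2 * n), hL, hker, isUnbounded_of_inverse hLB fun c hc => ?_,
    hf.comp _ fun m n h => by simpa using h, fun n => ?_⟩
  · obtain ⟨n, hn⟩ := exists_norm_lt_of_isCompactOperator hDc
      (hf.comp (fun n => 2 * n + 1) fun m n h => by simpa using h) hc
    refine ⟨f (2 * n + 1), hf.1 _, ?_⟩
    rw [hB, hPodd, sub_self, zero_add]
    exact (V.norm_starProjection_apply_le _).trans_lt hn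
  · have h := hLB (f (2 * n))
    have hfix : B (f (2 * n)) = f (2 * n) := by
      rw [hB, hPeven, map_zero, map_zero, sub_zero, add_zero]
    simpa only [hfix] using h

end Complete

end SectorialOps

open SectorialOps in
theorem theorem3p1 {H : Type*} [NormedAddCommGroup H] [InnerProductSpace ℂ H] [CompleteSpace H]
    [TopologicalSpace.SeparableSpace H] (hH : ¬ FiniteDimensional ℂ H) :
    -- an m-sectorial operator with trivial domain intersection and compact resolvent
    (∃ (A L : H →ₗ.[ℂ] H) (G : H →L[ℂ] H), IsMSectorial A ∧ A.domain ⊓ A†.domain = ⊥ ∧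
      HasCompactResolvent A ∧ IsAdmissible L G ∧ A = sandwich L G) ∧
    -- an m-sectorial operator with trivial domain intersection and non-compact resolvent
    (∃ (A L : H →ₗ.[ℂ] H) (G : H →L[ℂ] H), IsMSectorial A ∧ A.domain ⊓ A†.domain = ⊥ ∧
      ¬ HasCompactResolvent A ∧ IsAdmissible L G ∧ A = sandwich L G) ∧
    -- trivial domain intersection forces trivial kernel
    (∀ A : H →ₗ.[ℂ] H, IsMSectorial A → A.domain ⊓ A†.domain = ⊥ →
      LinearMap.ker A.toFun = ⊥) ∧
    -- every admissible pair gives such an operator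
    (∀ (L : H →ₗ.[ℂ] H) (G : H →L[ℂ] H), IsAdmissible L G →
      IsMSectorial (sandwich L G) ∧ (sandwich L G).domain ⊓ (sandwich L G)†.domain = ⊥) ∧
    -- every unbounded selfadjoint operator with trivial kernel is part of an admissible pair
    (∀ L : H →ₗ.[ℂ] H, IsSelfAdjoint L → IsUnbounded L → LinearMap.ker L.toFun = ⊥ →
      ∃ G : H →L[ℂ] H, IsAdmissible L G) := by
  refine ⟨?_, ?_, fun A => ker_eq_bot_of_isMSectorial,
    fun L G h => ⟨isMSectorial_sandwich h.1 h.2.2.1 h.2.1, sandwich_domain_inf_adjoint_domain h⟩,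
    fun L => exists_isAdmissible⟩
  · obtain ⟨L, D, hL, hker, hunb, hDc, hDL⟩ := exists_inverse_isCompactOperator hH
    obtain ⟨G, hG⟩ := exists_isAdmissible hL hunb hker
    exact ⟨_, L, G, isMSectorial_sandwich hL hG.2.2.1 hker, sandwich_domain_inf_adjoint_domain hG,
      hasCompactResolvent_sandwich hL hG.2.2.1 hDc hDL, hG, rfl⟩
  · obtain ⟨L, e, hL, hker, hunb, he, hLe⟩ := exists_isUnbounded_fixing_orthonormal hH
    obtain ⟨G, hG⟩ := exists_isAdmissible hL hunb hker
    exact ⟨_, L, G, isMSectorial_sandwich hL hG.2.2.1 hker, sandwich_domain_inf_adjoint_domain hG,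
      not_hasCompactResolvent_sandwich hL hG.2.2.1 he hLe, hG, rfl⟩
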